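/- Let $(X,\mathcal A,\mu)$ be a $\sigma$-finite measure space with $\mu(X)=\infty$, let $T:X\to X$ be a conservative, ergodic, measure-preserving transformation, and let $Y\in\mathcal A$ with $0<\mu(Y)<\infty$. Notation. The transfer operator is $\hat T u=d(\mu_u\circ T^{-1})/d\mu$ for measurable $u\ge 0$, where $\mu_u(A)=\int_A u\,d\mu$. A family $\mathfrak H$ of non-negative measurable functions is *uniformly sweeping for* a non-negative measurable function $G$ if there are $C>0$ and $K\in\{0,1,2,\dots\}$ such that $C\sum_{k=0}^K\hat T^kH\ge G$ a.e. for every $H\in\mathfrak H$; a single function $H$ is uniformly sweeping for $G$ if $\{H\}$ is. Put $Y_0=Y$, $Y_n=(T^{-n}Y)\setminus\bigcup_{k=0}^{n-1}T^{-k}Y$ for $n\ge1$, $w_n=\mu\big(\bigcup_{k=0}^{n-1}T^{-k}Y\big)$, and $Z_n^Y(x)=\max\{k\le n: T^kx\in Y\}$ (with $k\ge 0$ and $\max\emptyset=0$). Assume further: - $w_n\sim n^{1-\alpha}\ell(n)$ as $n\to\infty$ for some $\alpha\in(0,1)$ and some measurable $\ell:(0,\infty)\to(0,\infty)$ slowly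 varying at $\infty$ (that is, $\ell(\lambda t)/\ell(t)\to1$ as $t\to\infty$ for every $\lambda>0$); - there is $N\ge1$ such that the family $\big\{w_n^{-1}\sum_{k=0}^{n-1}\hat T^k1_{Y_k}\big\}_{n\ge N}$ is uniformly sweeping for $1_Y$; - there is $H\in L^\infty(\mu)$ such that $w_n^{-1}\sum_{k=0}^{n-1}\hat T^k1_{Y_k}\to H$ in $L^\infty(\mu)$ as $n\to\infty$. Let $G\in L^1(\mu)$ with $G\ge0$. Then the following hold. 1. If $G$ is uniformly sweeping for $1_Y$, then there exists $C_1\in(0,\infty)$ such that for every positive-valued sequence $\{c(n)\}_{n\ge0}$ with $c(n)\to0$ and $c(n)n\to\infty$, $$C_1\le\liminf_{n\to\infty}\frac{\ell(c(n)n)}{c(n)^\alpha\,\ell(n)}\;\mu_G\Big(\frac{Z_n^Y}{n}\le c(n)\Big).$$ 2. If $1_Y$ is uniformly sweeping for $G$, then there exists $C_2\in(0,\infty)$ such that for every positive-valued sequence $\{c(n)\}_{n\ge0}$ with $c(n)\to0$ and $c(n)n\to\infty$, $$\limsup_{n\to\infty}\frac{\ell(c(n)n)}{c(n)^\alpha\,\ell(n)}\;\mu_G\Big(\frac{Z_n^Y}{n}\le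 c(n)\Big)\le C_2.$$ -/

import Mathlib

open MeasureTheory Filter Topology
open scoped ENNReal NNReal

namespace InfErg

noncomputable section

/-- The transfer operator of `T` on non-negative (extended-valued) functions:
`T̂ u = d(μ_u ∘ T⁻¹)/dμ`, where `μ_u` is the measure with `μ`-density `u`. -/
def transfer {X : Type*} [MeasurableSpace X] (μ : Measure X) (T : X → X)
    (u : X → ℝ≥0∞) : X → ℝ≥0∞ :=
  ((μ.withDensity u).map T).rnDeriv μ

/-- A family `𝓗` of non-negative functions is uniformly sweeping for `G`: there are a constant
`C > 0` and `K ∈ {0, 1, 2, …}` such that `C ∑_{k=0}^K T̂^k H ≥ G` a.e., for every `H ∈ 𝓗`. -/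
def UniformlySweepingFamily {X : Type*} [MeasurableSpace X] (μ : Measure X) (T : X → X)
    (𝓗 : Set (X → ℝ≥0∞)) (G : X → ℝ≥0∞) : Prop :=
  ∃ C : ℝ≥0, 0 < C ∧ ∃ K : ℕ, ∀ H ∈ 𝓗,
    ∀ᵐ x ∂μ, G x ≤ (C : ℝ≥0∞) * ∑ k ∈ Finset.range (K + 1), ((transfer μ T)^[k] H) x

/-- A single function `H` is uniformly sweeping for `G`. -/
def UniformlySweeping {X : Type*} [MeasurableSpace X] (μ : Measure X) (T : X → X)
    (H G : X → ℝ≥0∞) : Prop :=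
  UniformlySweepingFamily μ T {H} G

/-- `ℓ : (0,∞) → (0,∞)` is positive, measurable and slowly varying at `∞`
(the values of `ℓ` on `(-∞,0]` are irrelevant). -/
structure SlowlyVarying (ℓ : ℝ → ℝ) : Prop where
  measurable : Measurable (fun t : Set.Ioi (0 : ℝ) => ℓ t)
  pos : ∀ t : ℝ, 0 < t → 0 < ℓ t
  tendsto : ∀ r : ℝ, 0 < r → Tendsto (fun t : ℝ => ℓ (r * t) / ℓ t) atTop (𝓝 1)

/-- The set `Y_n` of points whose orbit visits `Y` for the first time at time `n ≥ 0`: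
`Y_0 = Y` and `Y_n = T⁻ⁿ Y ∖ ⋃_{k<n} T⁻ᵏ Y`. -/
def firstEntry {X : Type*} (T : X → X) (Y : Set X) (n : ℕ) : Set X :=
  (T^[n] ⁻¹' Y) \ ⋃ k ∈ Finset.range n, T^[k] ⁻¹' Y

/-- The wandering rate `w_n = μ(⋃_{k<n} T⁻ᵏ Y)`. -/
def wanderingRate {X : Type*} [MeasurableSpace X] (μ : Measure X) (T : X → X)
    (Y : Set X) (n : ℕ) : ℝ≥0∞ :=
  μ (⋃ k ∈ Finset.range n, T^[k] ⁻¹' Y)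

/-- The averaged entrance density `(w_n)⁻¹ ∑_{k<n} T̂ᵏ 1_{Y_k}`. -/
def entranceDensity {X : Type*} [MeasurableSpace X] (μ : Measure X) (T : X → X)
    (Y : Set X) (n : ℕ) (x : X) : ℝ≥0∞ :=
  (wanderingRate μ T Y n)⁻¹ *
    ∑ k ∈ Finset.range n, ((transfer μ T)^[k] ((firstEntry T Y k).indicator 1)) x

/-- `H ∈ L^∞(μ)` is the limit in `L^∞(μ)` of the averaged entrance densities of `Y`. -/
def IsAsymptoticEntranceDensity {X : Type*} [MeasurableSpace X] (μ : Measure X) (T : X → X)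
    (Y : Set X) (H : X → ℝ) : Prop :=
  MemLp H ∞ μ ∧
    Tendsto (fun n : ℕ => eLpNorm (fun x => (entranceDensity μ T Y n x).toReal - H x) ∞ μ)
      atTop (𝓝 0)

open Classical in
/-- `Z_n(x) = max {k ≤ n : Tᵏ x ∈ Y}`, with `max ∅ = 0`. -/
def lastVisit {X : Type*} (T : X → X) (Y : Set X) (n : ℕ) (x : X) : ℕ :=
  Nat.findGreatest (fun k => T^[k] x ∈ Y) n

/-- The normalized quantity
`ℓ(c(n)n) / (c(n)^α ℓ(n)) · μ_G(Z_n / n ≤ c(n))`, where `μ_G(A) = ∫_A G dμ`. -/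
def normalizedProb {X : Type*} [MeasurableSpace X] (μ : Measure X) (T : X → X)
    (Y : Set X) (α : ℝ) (ℓ : ℝ → ℝ) (G : X → ℝ) (c : ℕ → ℝ) (n : ℕ) : ℝ :=
  ℓ (c n * n) / (c n ^ α * ℓ n) *
    ∫ x in {x | (lastVisit T Y n x : ℝ) / (n : ℝ) ≤ c n}, G x ∂μ

end

end InfErg

/-! Let q_n be the measure of `excursion T Y n`, m = ⌊c(n)n⌋, and ν = μ_G. The claim reduces to
ν(Z_n ≤ m) ≍ (m / w_m)(w_n / n), since regular variation turns the right side into c(n)^α ℓ(n) /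
ℓ(c(n)n) (`tendsto_normalization`). The event Z_n ≤ m says that the last visit up to time n starts a
long excursion at a time of order at most m. Sweeping exchanges ν for μ on Y at the cost of bounded
time shifts, so the event is compared with `visitMass` of a long excursion set
(`visitMass_excursion_le`, `measure_noVisit_le`). The renewal identity `sum_entranceMass` gives
visit mass ≍ (m / w_m) μ(B): boundedness of the entrance densities yields the lower bound, their
uniform sweeping the upper one. Finally q_n ≍ w_n / n, because w_n is the sum of the decreasing q_k
and w_{2n} / w_n tends to 2^(1-α) > 1. -/

namespace InfErg

/-! ### Duality for the transfer operator -/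

section Transfer

variable {X : Type*} [MeasurableSpace X] {μ : Measure X} [SigmaFinite μ] {T : X → X}

/-- Invariance makes the pushforward absolutely continuous and integrability of `u` makes it finite,
so its Radon–Nikodym derivative recovers it. -/
theorem setLIntegral_transfer (hT : MeasurePreserving T μ μ) {u : X → ℝ≥0∞}
    (hu : ∫⁻ x, u x ∂μ ≠ ∞) {A : Set X} (hA : MeasurableSet A) :
    ∫⁻ x in A, transfer μ T u x ∂μ = ∫⁻ x in T ⁻¹' A, u x ∂μ := by
  have hfin : IsFiniteMeasure (μ.withDensity u) := isFiniteMeasure_withDensity hu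
  have hac : (μ.withDensity u).map T ≪ μ := by
    have h := (withDensity_absolutelyContinuous μ u).map hT.measurable
    rwa [hT.map_eq] at h
  rw [transfer, ← withDensity_apply _ hA, Measure.withDensity_rnDeriv_eq _ _ hac,
    Measure.map_apply hT.measurable hA, withDensity_apply _ (hT.measurable hA)]

theorem setLIntegral_transfer_iterate (hT : MeasurePreserving T μ μ) (k : ℕ) {u : X → ℝ≥0∞}
    (hu : ∫⁻ x, u x ∂μ ≠ ∞) {A : Set X} (hA : MeasurableSet A) :
    ∫⁻ x in A, ((transfer μ T)^[k] u) x ∂μ = ∫⁻ x in T^[k] ⁻¹' A, u x ∂μ := by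
  induction k generalizing u with
  | zero => rfl
  | succ k ih =>
    have hu' : ∫⁻ x, transfer μ T u x ∂μ ≠ ∞ := by
      have h := setLIntegral_transfer hT hu MeasurableSet.univ
      simp only [Measure.restrict_univ, Set.preimage_univ] at h
      rwa [h]
    rw [Function.iterate_succ_apply, ih hu',
      setLIntegral_transfer hT hu (hT.measurable.iterate k hA), ← Set.preimage_comp,
      ← Function.iterate_succ]

omit [SigmaFinite μ] in
theorem aemeasurable_transfer_iterate (k : ℕ) {u : X → ℝ≥0∞} (hu : AEMeasurable u μ) :
    AEMeasurable ((transfer μ T)^[k] u) μ := by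
  cases k with
  | zero => exact hu
  | succ k =>
    rw [Function.iterate_succ_apply']
    exact (Measure.measurable_rnDeriv _ _).aemeasurable

/-- Sweeping, read off on measurable sets. -/
theorem setLIntegral_le_of_sweeping (hT : MeasurePreserving T μ μ) {u G : X → ℝ≥0∞}
    (hum : AEMeasurable u μ) (hu : ∫⁻ x, u x ∂μ ≠ ∞) {C : ℝ≥0} {K : ℕ}
    (h : ∀ᵐ x ∂μ, G x ≤ (C : ℝ≥0∞) * ∑ k ∈ Finset.range (K + 1), ((transfer μ T)^[k] u) x)
    {A : Set X} (hA : MeasurableSet A) :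
    ∫⁻ x in A, G x ∂μ ≤
      (C : ℝ≥0∞) * ∑ k ∈ Finset.range (K + 1), ∫⁻ x in T^[k] ⁻¹' A, u x ∂μ := by
  calc ∫⁻ x in A, G x ∂μ
      ≤ ∫⁻ x in A, (C : ℝ≥0∞) * ∑ k ∈ Finset.range (K + 1), ((transfer μ T)^[k] u) x ∂μ :=
        lintegral_mono_ae (ae_restrict_of_ae h)
    _ = (C : ℝ≥0∞) * ∑ k ∈ Finset.range (K + 1), ∫⁻ x in T^[k] ⁻¹' A, u x ∂μ := by
        rw [lintegral_const_mul' _ _ ENNReal.coe_ne_top, lintegral_finsetSum']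
        · simp only [setLIntegral_transfer_iterate hT _ hu hA]
        · exact fun k _ => (aemeasurable_transfer_iterate k hum).restrict

end Transfer

/-! ### Excursions, gaps between visits, first entries -/

section Sets

variable {X : Type*}

/-- The points of `Y` that do not return to `Y` up to time `n`. -/
def excursion (T : X → X) (Y : Set X) (n : ℕ) : Set X :=
  {x | x ∈ Y ∧ ∀ j, 0 < j → j ≤ n → T^[j] x ∉ Y}

/-- The points whose orbit avoids `Y` during the times in `(m, n]`. -/
def noVisit (T : X → X) (Y : Set X) (m n : ℕ) : Set X :=
  {x | ∀ k, m < k → k ≤ n → T^[k] x ∉ Y}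

variable {T : X → X} {Y : Set X}

theorem excursion_subset (n : ℕ) : excursion T Y n ⊆ Y := fun _ hx => hx.1

theorem excursion_antitone : Antitone (excursion T Y) :=
  fun _ _ h _ hx => ⟨hx.1, fun j hj hjn => hx.2 j hj (hjn.trans h)⟩

/-- The convention max ∅ = 0 is harmless: only times k > m ≥ 0 are tested, and a nonzero value is a
genuine visit. -/
theorem lastVisit_le_iff {m n : ℕ} {x : X} : lastVisit T Y n x ≤ m ↔ x ∈ noVisit T Y m n := by
  classical
  constructor
  · exact fun h k hk hkn => Nat.findGreatest_is_greatest (P := fun k => T^[k] x ∈ Y)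
      (lt_of_le_of_lt h hk) hkn
  · intro h
    by_contra! hlt
    exact h _ hlt (Nat.findGreatest_le _)
      (Nat.findGreatest_of_ne_zero (P := fun k => T^[k] x ∈ Y) rfl (by omega))

variable [MeasurableSpace X]

theorem measurableSet_noVisit (hT : Measurable T) (hY : MeasurableSet Y) (m n : ℕ) :
    MeasurableSet (noVisit T Y m n) := by
  have : noVisit T Y m n = ⋂ (k : ℕ) (_ : m < k) (_ : k ≤ n), (T^[k] ⁻¹' Y)ᶜ := by
    ext x; simp [noVisit]
  rw [this]
  exact .iInter fun k => .iInter fun _ => .iInter fun _ => (hT.iterate k hY).compl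

theorem measurableSet_excursion (hT : Measurable T) (hY : MeasurableSet Y) (n : ℕ) :
    MeasurableSet (excursion T Y n) :=
  hY.inter (measurableSet_noVisit hT hY 0 n)

theorem measurableSet_firstEntry (hT : Measurable T) (hY : MeasurableSet Y) (n : ℕ) :
    MeasurableSet (firstEntry T Y n) :=
  (hT.iterate n hY).diff (Finset.measurableSet_biUnion _ fun k _ => hT.iterate k hY)

omit [MeasurableSpace X] in
theorem mem_firstEntry {n : ℕ} {x : X} :
    x ∈ firstEntry T Y n ↔ T^[n] x ∈ Y ∧ ∀ k < n, T^[k] x ∉ Y := by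
  simp [firstEntry]

omit [MeasurableSpace X] in
theorem pairwise_disjoint_firstEntry : Pairwise (Function.onFun Disjoint (firstEntry T Y)) := by
  intro i j hij
  refine Set.disjoint_left.2 fun x hi hj => ?_
  rw [mem_firstEntry] at hi hj
  rcases lt_or_gt_of_ne hij with h | h
  · exact hj.2 i h hi.1
  · exact hi.2 j h hj.1

end Sets

section Sums

theorem sum_range_shift_le (f : ℕ → ℝ≥0∞) {i K : ℕ} (hi : i ≤ K) (n : ℕ) :
    ∑ k ∈ Finset.range n, f (i + k) ≤ ∑ k ∈ Finset.range (n + K), f k := by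
  calc ∑ k ∈ Finset.range n, f (i + k)
      ≤ ∑ k ∈ Finset.range i, f k + ∑ k ∈ Finset.range n, f (i + k) := le_add_self
    _ = ∑ k ∈ Finset.range (i + n), f k := (Finset.sum_range_add f i n).symm
    _ ≤ ∑ k ∈ Finset.range (n + K), f k :=
        Finset.sum_le_sum_of_subset (Finset.range_subset_range.2 (by omega))

/-- The K + 1 time shifts of a sweeping bound cost a factor K + 1 and a window longer by K. -/
theorem sum_sum_range_shift_le (f : ℕ → ℝ≥0∞) (n K : ℕ) :
    ∑ k ∈ Finset.range n, ∑ i ∈ Finset.range (K + 1), f (i + k) ≤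
      (K + 1 : ℕ) * ∑ k ∈ Finset.range (n + K), f k := by
  rw [Finset.sum_comm]
  refine (Finset.sum_le_card_nsmul _ _ _ fun i hi =>
    sum_range_shift_le f (Nat.lt_succ_iff.1 (Finset.mem_range.1 hi)) n).trans ?_
  rw [Finset.card_range, nsmul_eq_mul]

end Sums

/-! ### Renewal identity and bounds on the visit mass -/

section Renewal

variable {X : Type*} [MeasurableSpace X] (μ : Measure X) (T : X → X) (Y : Set X)

/-- The mass that orbits deposit in `A` at their first entry time into `Y`, if this is `< n`. -/
noncomputable def entranceMass (n : ℕ) (A : Set X) : ℝ≥0∞ :=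
  ∑ k ∈ Finset.range n, μ (firstEntry T Y k ∩ T^[k] ⁻¹' A)

/-- The expected number of visits to `B` before time `n` for initial density `1_Y`. -/
noncomputable def visitMass (n : ℕ) (B : Set X) : ℝ≥0∞ :=
  ∑ k ∈ Finset.range n, μ (Y ∩ T^[k] ⁻¹' B)

variable {μ T Y}

theorem entranceMass_mono_left {m n : ℕ} (h : m ≤ n) (A : Set X) :
    entranceMass μ T Y m A ≤ entranceMass μ T Y n A :=
  Finset.sum_le_sum_of_subset (Finset.range_subset_range.2 h)

theorem entranceMass_inter (n : ℕ) (A : Set X) :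
    entranceMass μ T Y n (Y ∩ A) = entranceMass μ T Y n A := by
  refine Finset.sum_congr rfl fun k _ => ?_
  congr 1
  ext x
  simp only [Set.mem_inter_iff, Set.mem_preimage, mem_firstEntry]
  tauto

/-- Decomposition of `T⁻ⁿ B ⊆ T⁻ⁿ Y` by the first entry time into `Y`. -/
theorem sum_measure_firstEntry_inter (hT : MeasurePreserving T μ μ) (hY : MeasurableSet Y)
    {B : Set X} (hB : MeasurableSet B) (hBY : B ⊆ Y) (n : ℕ) :
    ∑ j ∈ Finset.range (n + 1), μ (firstEntry T Y j ∩ T^[n] ⁻¹' B) = μ B := by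
  classical
  rw [← measure_biUnion_finset, ← (hT.iterate n).measure_preimage hB.nullMeasurableSet]
  · congr 1
    ext x
    simp only [Set.mem_iUnion, Set.mem_inter_iff, Set.mem_preimage, mem_firstEntry,
      Finset.mem_range]
    constructor
    · rintro ⟨j, -, -, h⟩
      exact h
    · intro h
      have hex : ∃ j, T^[j] x ∈ Y := ⟨n, hBY h⟩
      exact ⟨Nat.find hex, Nat.lt_succ_of_le (Nat.find_min' hex (hBY h)),
        ⟨Nat.find_spec hex, fun k hk => Nat.find_min hex hk⟩, h⟩
  · exact fun i _ j _ hij => (pairwise_disjoint_firstEntry hij).mono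
      Set.inter_subset_left Set.inter_subset_left
  · exact fun j _ => (measurableSet_firstEntry hT.measurable hY j).inter
      (hT.measurable.iterate n hB)

/-- The renewal identity. -/
theorem sum_entranceMass (hT : MeasurePreserving T μ μ) (hY : MeasurableSet Y)
    {B : Set X} (hB : MeasurableSet B) (hBY : B ⊆ Y) (n : ℕ) :
    ∑ k ∈ Finset.range n, entranceMass μ T Y (n - k) (T^[k] ⁻¹' B) = n * μ B := by
  induction n with
  | zero => simp
  | succ n ih =>
    -- Each term gains only the entry time n - k. The gained events partition T⁻ⁿB by first entry
    -- and so add up to μ B; the new index k = n starts from an empty sum.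
    have hstep : ∀ k ∈ Finset.range (n + 1),
        entranceMass μ T Y (n + 1 - k) (T^[k] ⁻¹' B) =
          entranceMass μ T Y (n - k) (T^[k] ⁻¹' B) +
            μ (firstEntry T Y (n - k) ∩ T^[n] ⁻¹' B) := by
      intro k hk
      have hk' : k ≤ n := Nat.lt_succ_iff.1 (Finset.mem_range.1 hk)
      rw [Nat.succ_sub hk', entranceMass, Finset.sum_range_succ, ← entranceMass,
        ← Set.preimage_comp, ← Function.iterate_add, Nat.add_sub_cancel' hk']
    rw [Finset.sum_congr rfl hstep, Finset.sum_add_distrib, Finset.sum_range_succ, ih]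
    have hrefl := Finset.sum_range_reflect
      (fun j => μ (firstEntry T Y j ∩ T^[n] ⁻¹' B)) (n + 1)
    simp only [Nat.add_sub_cancel] at hrefl
    rw [hrefl, sum_measure_firstEntry_inter hT hY hB hBY, Nat.sub_self]
    simp [entranceMass, add_mul]

/-- Enlarge n - k to n in every term of the renewal identity, then apply the upper bound on the
entrance mass. -/
theorem mul_measure_le_visitMass (hT : MeasurePreserving T μ μ) (hY : MeasurableSet Y)
    {n : ℕ} {c : ℝ≥0∞}
    (hc : ∀ A, MeasurableSet A → entranceMass μ T Y n A ≤ c * μ (Y ∩ A))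
    {B : Set X} (hB : MeasurableSet B) (hBY : B ⊆ Y) :
    n * μ B ≤ c * visitMass μ T Y n B := by
  rw [← sum_entranceMass hT hY hB hBY, visitMass, Finset.mul_sum]
  exact Finset.sum_le_sum fun k _ => (entranceMass_mono_left (Nat.sub_le _ _) _).trans
    (hc _ (hT.measurable.iterate k hB))

/-- For k < n + K the entrance mass up to p is at most that up to n + K + p - k, a term of the
renewal identity of length n + K + p. -/
theorem visitMass_le_mul_measure (hT : MeasurePreserving T μ μ) (hY : MeasurableSet Y)
    {p K : ℕ} {c : ℝ≥0∞}
    (hc : ∀ A, MeasurableSet A →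
      μ (Y ∩ A) ≤ c * ∑ i ∈ Finset.range (K + 1), entranceMass μ T Y p (T^[i] ⁻¹' A))
    {B : Set X} (hB : MeasurableSet B) (hBY : B ⊆ Y) (n : ℕ) :
    visitMass μ T Y n B ≤ c * ((K + 1 : ℕ) * ((n + K + p : ℕ) * μ B)) := by
  calc visitMass μ T Y n B
      ≤ ∑ k ∈ Finset.range n, c * ∑ i ∈ Finset.range (K + 1),
          entranceMass μ T Y p (T^[i + k] ⁻¹' B) := by
        refine Finset.sum_le_sum fun k _ => (hc _ (hT.measurable.iterate k hB)).trans_eq ?_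
        simp only [← Set.preimage_comp, ← Function.iterate_add, add_comm]
    _ ≤ c * ((K + 1 : ℕ) * ∑ k ∈ Finset.range (n + K),
          entranceMass μ T Y p (T^[k] ⁻¹' B)) := by
        rw [← Finset.mul_sum]
        gcongr
        exact sum_sum_range_shift_le (fun k => entranceMass μ T Y p (T^[k] ⁻¹' B)) n K
    _ ≤ c * ((K + 1 : ℕ) * ((n + K + p : ℕ) * μ B)) := by
        rw [← sum_entranceMass hT hY hB hBY]
        gcongr
        refine (Finset.sum_le_sum fun k hk => ?_).trans
          (Finset.sum_le_sum_of_subset (Finset.range_subset_range.2 (Nat.le_add_right _ p)))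
        have := Finset.mem_range.1 hk
        exact entranceMass_mono_left (by omega) _

end Renewal

/-! ### Late gaps in the visits compared with long excursions -/

section LastVisit

variable {X : Type*} [MeasurableSpace X] {μ ν : Measure X} {T : X → X} {Y : Set X}

/-- An excursion longer than n begun before p + K covers (p + K, n]. As p + K ≤ n, two different
starts are incompatible, so the preimages are disjoint and their measures add. -/
theorem visitMass_excursion_le (hT : Measurable T) (hY : MeasurableSet Y) {K : ℕ} {c : ℝ≥0∞}
    (hc : ∀ A, MeasurableSet A → μ (Y ∩ A) ≤ c * ∑ i ∈ Finset.range (K + 1), ν (T^[i] ⁻¹' A))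
    {p n : ℕ} (hpn : p + K ≤ n) :
    visitMass μ T Y p (excursion T Y n) ≤ c * ((K + 1 : ℕ) * ν (noVisit T Y (p + K) n)) := by
  have hB := measurableSet_excursion hT hY n
  calc visitMass μ T Y p (excursion T Y n)
      ≤ ∑ k ∈ Finset.range p, c * ∑ i ∈ Finset.range (K + 1),
          ν (T^[i + k] ⁻¹' excursion T Y n) := by
        refine Finset.sum_le_sum fun k _ => (hc _ (hT.iterate k hB)).trans_eq ?_
        simp only [← Set.preimage_comp, ← Function.iterate_add, add_comm]
    _ ≤ c * ((K + 1 : ℕ) * ∑ k ∈ Finset.range (p + K), ν (T^[k] ⁻¹' excursion T Y n)) := by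
        rw [← Finset.mul_sum]
        gcongr
        exact sum_sum_range_shift_le (fun k => ν (T^[k] ⁻¹' excursion T Y n)) p K
    _ ≤ c * ((K + 1 : ℕ) * ν (noVisit T Y (p + K) n)) := by
        rw [← measure_biUnion_finset]
        · gcongr
          intro x hx k hk hkn
          simp only [Set.mem_iUnion, Finset.mem_range] at hx
          obtain ⟨i, hi, hx⟩ := hx
          have := hx.2 (k - i) (by omega) (by omega)
          rwa [← Function.iterate_add_apply, Nat.sub_add_cancel (by omega)] at this
        · have key : ∀ i ∈ Finset.range (p + K), ∀ j ∈ Finset.range (p + K), i < j →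
              Disjoint (T^[i] ⁻¹' excursion T Y n) (T^[j] ⁻¹' excursion T Y n) := by
            intro i _ j hj hij
            have hj' := Finset.mem_range.1 hj
            refine Set.disjoint_left.2 fun x hxi hxj => ?_
            have := hxi.2 (j - i) (by omega) (by omega)
            rw [← Function.iterate_add_apply, Nat.sub_add_cancel (by omega)] at this
            exact this hxj.1
          intro i hi j hj hij
          rcases lt_or_gt_of_ne hij with h | h
          · exact key i hi j hj h
          · exact (key j hj i hi h).symm
        · exact fun k _ => hT.iterate k hB

theorem measure_noVisit_le (hT : Measurable T) (hY : MeasurableSet Y) {K : ℕ} {c : ℝ≥0∞}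
    (hc : ∀ A, MeasurableSet A → ν A ≤ c * ∑ i ∈ Finset.range (K + 1), μ (Y ∩ T^[i] ⁻¹' A))
    {m n : ℕ} :
    ν (noVisit T Y m n) ≤
      c * ((K + 1 : ℕ) * visitMass μ T Y (m + K + 1) (excursion T Y (n - m))) := by
  classical
  refine (hc _ (measurableSet_noVisit hT hY m n)).trans ?_
  gcongr
  rw [← nsmul_eq_mul]
  nth_rewrite 2 [← Finset.card_range (K + 1)]
  refine Finset.sum_le_card_nsmul _ _ _ fun i hi => ?_
  have hi' := Finset.mem_range.1 hi
  refine (measure_mono ?_).trans (measure_biUnion_finset_le (Finset.range (m + K + 1))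
    fun k => Y ∩ T^[k] ⁻¹' excursion T Y (n - m))
  rintro x ⟨hxY, hx⟩
  -- The last visit up to m + i begins an excursion longer than n - m: maximality excludes returns
  -- up to m + i, the gap (m, n] of Tⁱx those up to n + i.
  set j := Nat.findGreatest (fun k => T^[k] x ∈ Y) (m + i) with hj
  have hjle : j ≤ m + i := Nat.findGreatest_le _
  have hjY : T^[j] x ∈ Y :=
    Nat.findGreatest_spec (P := fun k => T^[k] x ∈ Y) (Nat.zero_le (m + i)) hxY
  simp only [Set.mem_iUnion, Finset.mem_range]
  refine ⟨j, by omega, hxY, hjY, fun l hl hln => ?_⟩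
  rw [← Function.iterate_add_apply]
  by_cases hlm : l + j ≤ m + i
  · exact Nat.findGreatest_is_greatest (P := fun k => T^[k] x ∈ Y) (by omega) hlm
  · have := hx (l + j - i) (by omega) (by omega)
    rwa [← Function.iterate_add_apply, Nat.sub_add_cancel (by omega)] at this

end LastVisit

/-! ### Slow variation and asymptotics of the normalisation -/

section SlowVariation

/-- The uniform convergence theorem for (additively) slowly varying measurable functions. -/
theorem tendsto_sub_of_forall_tendsto_sub {h : ℝ → ℝ} (hm : Measurable h)
    (hs : ∀ s, Tendsto (fun x => h (x + s) - h x) atTop (𝓝 0)) {x u : ℕ → ℝ}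
    (hx : Tendsto x atTop atTop) (hu0 : ∀ n, 0 ≤ u n) (hu1 : ∀ n, u n ≤ 1) :
    Tendsto (fun n => h (x n + u n) - h (x n)) atTop (𝓝 0) := by
  -- A bounded subadditive substitute for |y|: dominated convergence applies although h need not be
  -- locally integrable.
  set φ : ℝ → ℝ := fun y => min 1 |y| with hφ
  have hφc : Continuous φ := by fun_prop
  have hφ0 : ∀ y, 0 ≤ φ y := fun y => le_min zero_le_one (abs_nonneg y)
  have hφ1 : ∀ y, φ y ≤ 1 := fun y => min_le_left _ _
  have hφadd : ∀ y z, φ (y - z) ≤ φ y + φ z := by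
    intro y z
    have h3 : |y - z| ≤ |y| + |z| := abs_sub y z
    simp only [hφ]
    rcases le_total 1 |y| with h1 | h1 <;> rcases le_total 1 |z| with h2 | h2 <;>
      simp only [min_eq_left, min_eq_right, h1, h2]
    · exact (min_le_left _ _).trans (by norm_num)
    · exact (min_le_left _ _).trans (by linarith [abs_nonneg z])
    · exact (min_le_left _ _).trans (by linarith [abs_nonneg y])
    · exact (min_le_right _ _).trans h3
  have hmeas : ∀ a b : ℝ, Measurable fun s => φ (h (a + s) - b) := fun a b =>
    hφc.measurable.comp ((hm.comp (measurable_const_add a)).sub_const b)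
  have hint : ∀ a b p q : ℝ, IntervalIntegrable (fun s => φ (h (a + s) - b)) volume p q := by
    intro a b p q
    refine (intervalIntegrable_const (c := (1 : ℝ))).mono_fun
      (hmeas a b).aestronglyMeasurable (.of_forall fun s => ?_)
    simp only [Real.norm_of_nonneg (hφ0 _), norm_one]
    exact hφ1 _
  have hlim : ∀ (y : ℕ → ℝ) (p : ℝ), Tendsto y atTop atTop →
      Tendsto (fun n => ∫ s in (0 : ℝ)..p, φ (h (y n + s) - h (y n))) atTop (𝓝 0) := by
    intro y p hy
    have := intervalIntegral.tendsto_integral_filter_of_dominated_convergence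
      (F := fun n s => φ (h (y n + s) - h (y n))) (f := fun _ => (0 : ℝ)) (a := 0) (b := p)
      (μ := volume) (l := atTop) (fun _ => (1 : ℝ))
      (.of_forall fun n => (hmeas _ _).aestronglyMeasurable)
      (.of_forall fun n => .of_forall fun s _ => by
        rw [Real.norm_of_nonneg (hφ0 _)]; exact hφ1 _)
      intervalIntegrable_const
      (.of_forall fun s _ => by
        have h0 := (hφc.tendsto 0).comp ((hs s).comp hy)
        have h1 : φ 0 = 0 := by simp [hφ]
        rwa [h1] at h0)
    simpa using this
  have hxu : Tendsto (fun n => x n + u n) atTop atTop :=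
    tendsto_atTop_mono (fun n => le_add_of_nonneg_right (hu0 n)) hx
  -- Average the triangle inequality through h(x_n + u_n + s) over s in [0, 1]; after translation by
  -- u_n the first integral lives in [0, 2].
  have hbound : ∀ n, φ (h (x n + u n) - h (x n)) ≤
      (∫ s in (0 : ℝ)..2, φ (h (x n + s) - h (x n))) +
        ∫ s in (0 : ℝ)..1, φ (h (x n + u n + s) - h (x n + u n)) := by
    intro n
    have h1 : φ (h (x n + u n) - h (x n)) ≤
        ∫ s in (0 : ℝ)..1, (φ (h (x n + u n + s) - h (x n)) +
          φ (h (x n + u n + s) - h (x n + u n))) := by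
      have hc : ∫ _ in (0 : ℝ)..1, φ (h (x n + u n) - h (x n)) =
          φ (h (x n + u n) - h (x n)) := by simp
      rw [← hc]
      refine intervalIntegral.integral_mono_on zero_le_one intervalIntegrable_const
        ((hint _ _ _ _).add (hint _ _ _ _)) fun s _ => ?_
      have := hφadd (h (x n + u n + s) - h (x n)) (h (x n + u n + s) - h (x n + u n))
      rwa [sub_sub_sub_cancel_left] at this
    rw [intervalIntegral.integral_add (hint _ _ _ _) (hint _ _ _ _)] at h1
    refine h1.trans (add_le_add_left ?_ _)
    have h2 : ∫ s in (0 : ℝ)..1, φ (h (x n + u n + s) - h (x n)) =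
        ∫ s in (u n)..(u n + 1), φ (h (x n + s) - h (x n)) := by
      have := intervalIntegral.integral_comp_add_left
        (fun s => φ (h (x n + s) - h (x n))) (u n) (a := 0) (b := 1)
      simpa [add_assoc] using this
    rw [h2]
    exact intervalIntegral.integral_mono_interval (hu0 n) (by linarith) (by linarith [hu1 n])
      (.of_forall fun s => hφ0 _) (hint _ _ _ _)
  have hφlim : Tendsto (fun n => φ (h (x n + u n) - h (x n))) atTop (𝓝 0) := by
    refine squeeze_zero (fun n => hφ0 _) hbound ?_
    simpa using (hlim x 2 hx).add (hlim _ 1 hxu)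
  rw [Metric.tendsto_atTop] at hφlim ⊢
  intro ε hε
  obtain ⟨N, hN⟩ := hφlim (min ε 1) (lt_min hε one_pos)
  refine ⟨N, fun n hn => ?_⟩
  have h1 := hN n hn
  rw [Real.dist_0_eq_abs, abs_of_nonneg (hφ0 _)] at h1
  rw [Real.dist_0_eq_abs]
  rcases min_lt_iff.1 (h1.trans_le (min_le_right _ _)) with h2 | h2
  · exact absurd h2 (lt_irrefl _)
  · have h3 : φ (h (x n + u n) - h (x n)) = |h (x n + u n) - h (x n)| := min_eq_right h2.le
    rw [← h3]
    exact h1.trans_le (min_le_left _ _)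

/-- The ratio t / ⌊t⌋ varies with n, so the uniform convergence theorem is needed; it is applied to
log ∘ ℓ ∘ exp. -/
theorem SlowlyVarying.tendsto_div_floor {ℓ : ℝ → ℝ} (hℓ : SlowlyVarying ℓ) {t : ℕ → ℝ}
    (ht : Tendsto t atTop atTop) :
    Tendsto (fun n => ℓ (t n) / ℓ (⌊t n⌋₊ : ℝ)) atTop (𝓝 1) := by
  have hpos : ∀ x, 0 < ℓ (Real.exp x) := fun x => hℓ.pos _ (Real.exp_pos x)
  have hm : Measurable fun x => Real.log (ℓ (Real.exp x)) :=
    Real.measurable_log.comp (hℓ.measurable.comp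
      (Real.measurable_exp.subtype_mk (h := fun x => Set.mem_Ioi.2 (Real.exp_pos x))))
  have hs : ∀ s, Tendsto
      (fun x => Real.log (ℓ (Real.exp (x + s))) - Real.log (ℓ (Real.exp x))) atTop (𝓝 0) := by
    intro s
    have h1 := ((hℓ.tendsto (Real.exp s) (Real.exp_pos s)).comp Real.tendsto_exp_atTop).log
      one_ne_zero
    rw [Real.log_one] at h1
    refine h1.congr fun x => ?_
    simp only [Function.comp_apply]
    rw [← Real.exp_add, add_comm s x, Real.log_div (hpos _).ne' (hpos _).ne']
  have hfl : Tendsto (fun n => (⌊t n⌋₊ : ℝ)) atTop atTop :=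
    tendsto_natCast_atTop_atTop.comp (tendsto_nat_floor_atTop.comp ht)
  -- The clamp gives the bounds for every n and is inactive once t n ≥ 1.
  set u : ℕ → ℝ := fun n => max 0 (min 1 (Real.log (t n) - Real.log ⌊t n⌋₊)) with hu
  have key := tendsto_sub_of_forall_tendsto_sub hm hs (Real.tendsto_log_atTop.comp hfl)
    (u := u) (fun n => le_max_left _ _) (fun n => max_le zero_le_one (min_le_left _ _))
  have key2 := (Real.continuous_exp.tendsto 0).comp key
  rw [Real.exp_zero] at key2
  refine key2.congr' ?_
  filter_upwards [ht.eventually_ge_atTop 1] with n hn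
  have hf1 : 1 ≤ ⌊t n⌋₊ := Nat.floor_pos.2 hn
  have hf1' : (1 : ℝ) ≤ ⌊t n⌋₊ := by exact_mod_cast hf1
  have hf0 : (0 : ℝ) < ⌊t n⌋₊ := by linarith
  have ht0 : 0 < t n := by linarith
  have hle : (⌊t n⌋₊ : ℝ) ≤ t n := Nat.floor_le ht0.le
  have hlt : t n < ⌊t n⌋₊ + 1 := Nat.lt_floor_add_one _
  have hun : u n = Real.log (t n) - Real.log ⌊t n⌋₊ := by
    have h0 : 0 ≤ Real.log (t n) - Real.log ⌊t n⌋₊ := sub_nonneg.2 (Real.log_le_log hf0 hle)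
    have h1 : Real.log (t n) - Real.log ⌊t n⌋₊ ≤ 1 := by
      rw [← Real.log_div ht0.ne' hf0.ne']
      refine (Real.log_le_sub_one_of_pos (by positivity)).trans ?_
      rw [sub_le_iff_le_add, div_le_iff₀ hf0]
      linarith
    simp only [hu]
    rw [min_eq_right h1, max_eq_right h0]
  simp only [Function.comp_apply]
  rw [hun, add_sub_cancel, Real.exp_log ht0, Real.exp_log hf0,
    ← Real.log_div (hℓ.pos _ ht0).ne' (hℓ.pos _ hf0).ne',
    Real.exp_log (div_pos (hℓ.pos _ ht0) (hℓ.pos _ hf0))]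

/-- If `w n ∼ n^{1-α} ℓ(n)`, then the normalisation compares with the wandering rates. -/
theorem tendsto_normalization {α : ℝ} {ℓ : ℝ → ℝ} (hℓ : SlowlyVarying ℓ) {w : ℕ → ℝ}
    (hw : Tendsto (fun n : ℕ => w n / ((n : ℝ) ^ (1 - α) * ℓ n)) atTop (𝓝 1))
    {c : ℕ → ℝ} (hc : ∀ n, 0 < c n) (ht : Tendsto (fun n : ℕ => c n * n) atTop atTop) :
    Tendsto (fun n : ℕ => ℓ (c n * n) / (c n ^ α * ℓ n) *
      ((⌊c n * n⌋₊ : ℝ) / w ⌊c n * n⌋₊ * (w n / n))) atTop (𝓝 1) := by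
  have hfl : Tendsto (fun n : ℕ => ⌊c n * n⌋₊) atTop atTop := tendsto_nat_floor_atTop.comp ht
  have h1 := hw.comp hfl
  have h2 := hℓ.tendsto_div_floor ht
  have h3 : Tendsto (fun n : ℕ => ((⌊c n * n⌋₊ : ℝ) / (c n * n)) ^ α) atTop (𝓝 1) := by
    have := (tendsto_nat_floor_div_atTop (R := ℝ)).comp ht
    simpa using this.rpow_const (p := α) (Or.inl one_ne_zero)
  have h4 := ((hw.div h1 one_ne_zero).mul h2).mul h3
  norm_num at h4
  refine h4.congr' ?_
  filter_upwards [ht.eventually_ge_atTop 1, eventually_ge_atTop 1] with n hn hn1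
  have hf : (0 : ℝ) < ⌊c n * n⌋₊ := by exact_mod_cast Nat.floor_pos.2 hn
  have hn0 : (0 : ℝ) < n := by exact_mod_cast hn1
  have hl1 := (hℓ.pos _ hf).ne'
  have hl2 := (hℓ.pos _ hn0).ne'
  have hcp := (Real.rpow_pos_of_pos (hc n) α).ne'
  have hnp := (Real.rpow_pos_of_pos hn0 α).ne'
  have hfp := (Real.rpow_pos_of_pos hf α).ne'
  rw [Real.div_rpow hf.le (mul_pos (hc n) hn0).le, Real.mul_rpow (hc n).le hn0.le,
    Real.rpow_sub hn0, Real.rpow_sub hf, Real.rpow_one, Real.rpow_one]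
  generalize (⌊c n * n⌋₊ : ℝ) ^ α = A at *
  generalize (n : ℝ) ^ α = B at *
  generalize c n ^ α = D at *
  generalize ℓ (⌊c n * n⌋₊ : ℝ) = E at *
  by_cases hwf : w ⌊c n * n⌋₊ = 0
  · simp [hwf]
  · field_simp

theorem tendsto_two_mul_div {α : ℝ} {ℓ : ℝ → ℝ} (hℓ : SlowlyVarying ℓ) {w : ℕ → ℝ}
    (hw : Tendsto (fun n : ℕ => w n / ((n : ℝ) ^ (1 - α) * ℓ n)) atTop (𝓝 1)) :
    Tendsto (fun n : ℕ => w (2 * n) / w n) atTop (𝓝 (2 ^ (1 - α))) := by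
  have h2 : Tendsto (fun n : ℕ => 2 * n) atTop atTop :=
    tendsto_id.const_mul_atTop' two_pos
  have h1 := hw.comp h2
  have h3 := (hℓ.tendsto 2 two_pos).comp (tendsto_natCast_atTop_atTop (R := ℝ))
  have h4 := ((h1.div hw one_ne_zero).mul h3).mul_const ((2 : ℝ) ^ (1 - α))
  rw [div_one, one_mul, one_mul] at h4
  refine h4.congr' ?_
  filter_upwards [eventually_ge_atTop 1] with n hn1
  have hn0 : (0 : ℝ) < n := by exact_mod_cast hn1
  have hl1 := (hℓ.pos _ hn0).ne'
  have hl2 := (hℓ.pos _ (mul_pos two_pos hn0)).ne'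
  have hnp := (Real.rpow_pos_of_pos hn0 (1 - α)).ne'
  have h2p := (Real.rpow_pos_of_pos (two_pos (α := ℝ)) (1 - α)).ne'
  simp only [Pi.div_apply, Function.comp_apply, Nat.cast_mul, Nat.cast_ofNat]
  rw [Real.mul_rpow zero_le_two hn0.le]
  by_cases hwf : w n = 0
  · simp [hwf]
  · field_simp

end SlowVariation

/-! ### Wandering rate as a sum of excursion tails -/

section WanderingRate

variable {X : Type*} [MeasurableSpace X] {μ : Measure X} {T : X → X} {Y : Set X}

/-- The longer union is the T-preimage of the shorter one together with the points of Y not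
returning by time n. -/
theorem wanderingRate_succ (hT : MeasurePreserving T μ μ) (hY : MeasurableSet Y) (n : ℕ) :
    wanderingRate μ T Y (n + 1) = wanderingRate μ T Y n + μ (excursion T Y n) := by
  have hA : MeasurableSet (⋃ k ∈ Finset.range n, T^[k] ⁻¹' Y) :=
    Finset.measurableSet_biUnion _ fun k _ => hT.measurable.iterate k hY
  rw [wanderingRate, wanderingRate, ← hT.measure_preimage hA.nullMeasurableSet,
    ← measure_union _ (measurableSet_excursion hT.measurable hY n)]
  · congr 1
    ext x
    simp only [Set.mem_iUnion, Finset.mem_range, Set.mem_preimage, Set.mem_union, excursion,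
      Set.mem_ofPred_eq, ← Function.iterate_succ_apply, exists_prop]
    constructor
    · rintro ⟨k, hk, hx⟩
      by_cases hex : ∃ i < n, T^[i + 1] x ∈ Y
      · exact .inl hex
      · push Not at hex
        rcases k with _ | k
        · refine .inr ⟨hx, fun j hj hjn => ?_⟩
          have := hex (j - 1) (by omega)
          rwa [Nat.sub_add_cancel hj] at this
        · exact absurd hx (hex k (by omega))
    · rintro (⟨i, hi, hx⟩ | ⟨hx, -⟩)
      · exact ⟨i + 1, by omega, hx⟩
      · exact ⟨0, by omega, hx⟩
  · refine Set.disjoint_left.2 fun x hx hx' => ?_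
    simp only [Set.mem_iUnion, Finset.mem_range, Set.mem_preimage, exists_prop,
      ← Function.iterate_succ_apply] at hx
    obtain ⟨i, hi, hx⟩ := hx
    exact hx'.2 (i + 1) (by omega) (by omega) hx

theorem wanderingRate_add (hT : MeasurePreserving T μ μ) (hY : MeasurableSet Y) (m n : ℕ) :
    wanderingRate μ T Y (m + n) =
      wanderingRate μ T Y m + ∑ k ∈ Finset.range n, μ (excursion T Y (m + k)) := by
  induction n with
  | zero => simp
  | succ n ih => rw [← add_assoc, wanderingRate_succ hT hY, ih, Finset.sum_range_succ, add_assoc]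

theorem wanderingRate_ne_top (hT : MeasurePreserving T μ μ) (hY : MeasurableSet Y)
    (hYfin : μ Y ≠ ∞) (n : ℕ) : wanderingRate μ T Y n ≠ ∞ := by
  refine ((measure_biUnion_finset_le _ _).trans_lt (ENNReal.sum_lt_top.2 fun k _ => ?_)).ne
  rw [(hT.iterate k).measure_preimage hY.nullMeasurableSet]
  exact hYfin.lt_top

theorem wanderingRate_mono : Monotone (wanderingRate μ T Y) := fun _ _ h =>
  measure_mono (Set.biUnion_mono (fun _ hk => Finset.range_subset_range.2 h hk) fun _ _ =>
    subset_rfl)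

theorem wanderingRate_ne_zero (hY0 : μ Y ≠ 0) {n : ℕ} (hn : 0 < n) :
    wanderingRate μ T Y n ≠ 0 := by
  refine (lt_of_lt_of_le (pos_iff_ne_zero.2 hY0) (measure_mono ?_)).ne'
  exact fun x hx => Set.mem_biUnion (Finset.mem_coe.2 (Finset.mem_range.2 hn)) hx

theorem mul_measure_excursion_le (hT : MeasurePreserving T μ μ) (hY : MeasurableSet Y) (n : ℕ) :
    n * μ (excursion T Y n) ≤ wanderingRate μ T Y n := by
  have h := wanderingRate_add hT hY 0 n
  simp only [zero_add] at h
  rw [h]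
  refine le_add_left ?_
  rw [← nsmul_eq_mul]
  nth_rewrite 1 [← Finset.card_range n]
  exact Finset.card_nsmul_le_sum _ _ _ fun k hk =>
    measure_mono (excursion_antitone (Finset.mem_range.1 hk).le)

theorem wanderingRate_two_mul_le (hT : MeasurePreserving T μ μ) (hY : MeasurableSet Y) (n : ℕ) :
    wanderingRate μ T Y (2 * n) ≤ wanderingRate μ T Y n + n * μ (excursion T Y n) := by
  rw [two_mul, wanderingRate_add hT hY n n]
  gcongr
  rw [← nsmul_eq_mul]
  refine (Finset.sum_le_card_nsmul (Finset.range n) _ (μ (excursion T Y n)) fun k _ =>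
    measure_mono (excursion_antitone (Nat.le_add_right n k))).trans_eq ?_
  rw [Finset.card_range]

end WanderingRate

/-! ### Entrance densities read off on sets -/

section Density

variable {X : Type*} [MeasurableSpace X] {μ : Measure X} [SigmaFinite μ] {T : X → X} {Y : Set X}

omit [SigmaFinite μ] in
theorem aemeasurable_entranceDensity (hT : Measurable T) (hY : MeasurableSet Y) (n : ℕ) :
    AEMeasurable (entranceDensity μ T Y n) μ := by
  refine AEMeasurable.const_mul (Finset.aemeasurable_fun_sum _ fun k _ => ?_) _
  exact aemeasurable_transfer_iterate k
    (aemeasurable_const.indicator (measurableSet_firstEntry hT hY k))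

theorem setLIntegral_entranceDensity (hT : MeasurePreserving T μ μ) (hY : MeasurableSet Y)
    (hYfin : μ Y ≠ ∞) (n : ℕ) {A : Set X} (hA : MeasurableSet A) :
    ∫⁻ x in A, entranceDensity μ T Y n x ∂μ =
      (wanderingRate μ T Y n)⁻¹ * entranceMass μ T Y n A := by
  have hm := fun k => measurableSet_firstEntry hT.measurable hY k
  have hk : ∀ k, AEMeasurable ((transfer μ T)^[k] ((firstEntry T Y k).indicator 1)) μ :=
    fun k => aemeasurable_transfer_iterate k (aemeasurable_const.indicator (hm k))
  simp only [entranceDensity]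
  rw [lintegral_const_mul'' _ (Finset.aemeasurable_fun_sum _ fun k _ => (hk k).restrict),
    lintegral_finsetSum' _ fun k _ => (hk k).restrict, entranceMass]
  congr 1
  refine Finset.sum_congr rfl fun k _ => ?_
  rw [setLIntegral_transfer_iterate hT k _ hA, lintegral_indicator_one (hm k),
    Measure.restrict_apply (hm k)]
  rw [lintegral_indicator_one (hm k)]
  refine ((measure_mono Set.sdiff_subset).trans_lt ?_).ne
  rw [(hT.iterate k).measure_preimage hY.nullMeasurableSet]
  exact hYfin.lt_top

theorem lintegral_entranceDensity_ne_top (hT : MeasurePreserving T μ μ) (hY : MeasurableSet Y)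
    (hY0 : μ Y ≠ 0) (hYfin : μ Y ≠ ∞) {n : ℕ} (hn : 0 < n) :
    ∫⁻ x, entranceDensity μ T Y n x ∂μ ≠ ∞ := by
  rw [← setLIntegral_univ, setLIntegral_entranceDensity hT hY hYfin n MeasurableSet.univ]
  refine ENNReal.mul_ne_top (ENNReal.inv_ne_top.2 (wanderingRate_ne_zero hY0 hn)) ?_
  refine (ENNReal.sum_lt_top.2 fun k _ => ?_).ne
  refine (measure_mono (Set.inter_subset_left.trans Set.sdiff_subset)).trans_lt ?_
  rw [(hT.iterate k).measure_preimage hY.nullMeasurableSet]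
  exact hYfin.lt_top

/-- Uniform convergence serves only to bound the densities eventually by ‖H‖_∞ + 1. -/
theorem exists_entranceMass_le (hT : MeasurePreserving T μ μ) (hY : MeasurableSet Y)
    (hY0 : μ Y ≠ 0) (hYfin : μ Y ≠ ∞)
    {H : X → ℝ} (hH : IsAsymptoticEntranceDensity μ T Y H) :
    ∃ b : ℝ≥0, 0 < b ∧ ∃ N : ℕ, ∀ n, N ≤ n → ∀ A, MeasurableSet A →
      entranceMass μ T Y n A ≤ b * wanderingRate μ T Y n * μ (Y ∩ A) := by
  obtain ⟨hHL, hlim⟩ := hH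
  refine ⟨(eLpNorm H ∞ μ).toNNReal + 1, by positivity, ?_⟩
  obtain ⟨N, hN⟩ := eventually_atTop.1 ((tendsto_order.1 hlim).2 1 one_pos)
  refine ⟨N + 1, fun n hn A hA => ?_⟩
  have hn0 : 0 < n := by omega
  have hfin := lintegral_entranceDensity_ne_top hT hY hY0 hYfin hn0
  have hae : ∀ᵐ x ∂μ, entranceDensity μ T Y n x ≤
      (((eLpNorm H ∞ μ).toNNReal + 1 : ℝ≥0) : ℝ≥0∞) := by
    have h1 := hN n (by omega)
    rw [eLpNorm_exponent_top] at h1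
    filter_upwards [ae_le_eLpNormEssSup (f := fun x => (entranceDensity μ T Y n x).toReal - H x)
        (μ := μ), ae_le_eLpNormEssSup (f := H) (μ := μ),
      ae_lt_top' (aemeasurable_entranceDensity hT.measurable hY n) hfin] with x hx1 hx2 hx3
    have hx4 : ‖(entranceDensity μ T Y n x).toReal‖ₑ = entranceDensity μ T Y n x := by
      rw [Real.enorm_eq_ofReal ENNReal.toReal_nonneg, ENNReal.ofReal_toReal hx3.ne]
    rw [ENNReal.coe_add, ENNReal.coe_toNNReal hHL.eLpNorm_lt_top.ne, ← hx4, ENNReal.coe_one]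
    calc ‖(entranceDensity μ T Y n x).toReal‖ₑ
        = ‖H x + ((entranceDensity μ T Y n x).toReal - H x)‖ₑ := by rw [add_sub_cancel]
      _ ≤ ‖H x‖ₑ + ‖(entranceDensity μ T Y n x).toReal - H x‖ₑ := enorm_add_le _ _
      _ ≤ eLpNorm H ∞ μ + 1 := by
          rw [eLpNorm_exponent_top]
          exact add_le_add hx2 (hx1.trans h1.le)
  have h5 := setLIntegral_entranceDensity hT hY hYfin n (hY.inter hA)
  rw [entranceMass_inter] at h5
  have h6 : ∫⁻ x in Y ∩ A, entranceDensity μ T Y n x ∂μ ≤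
      (((eLpNorm H ∞ μ).toNNReal + 1 : ℝ≥0) : ℝ≥0∞) * μ (Y ∩ A) := by
    refine (lintegral_mono_ae (ae_restrict_of_ae hae)).trans_eq ?_
    rw [setLIntegral_const]
  rw [h5, mul_comm (wanderingRate μ T Y n)⁻¹, ← div_eq_mul_inv,
    ENNReal.div_le_iff (wanderingRate_ne_zero hY0 hn0) (wanderingRate_ne_top hT hY hYfin n)] at h6
  rwa [mul_right_comm]

theorem setLIntegral_indicator_one {μ : Measure X} (hY : MeasurableSet Y) (A : Set X) :
    ∫⁻ x in A, Y.indicator 1 x ∂μ = μ (Y ∩ A) := by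
  rw [lintegral_indicator_one hY, Measure.restrict_apply hY]

theorem measure_inter_le_entranceMass (hT : MeasurePreserving T μ μ) (hY : MeasurableSet Y)
    (hY0 : μ Y ≠ 0) (hYfin : μ Y ≠ ∞) {p K : ℕ} (hp : 0 < p) {C : ℝ≥0}
    (h : ∀ᵐ x ∂μ, Y.indicator 1 x ≤ (C : ℝ≥0∞) * ∑ k ∈ Finset.range (K + 1),
      ((transfer μ T)^[k] (entranceDensity μ T Y p)) x) {A : Set X} (hA : MeasurableSet A) :
    μ (Y ∩ A) ≤ C * (wanderingRate μ T Y p)⁻¹ *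
      ∑ i ∈ Finset.range (K + 1), entranceMass μ T Y p (T^[i] ⁻¹' A) := by
  have h1 := setLIntegral_le_of_sweeping hT (aemeasurable_entranceDensity hT.measurable hY p)
    (lintegral_entranceDensity_ne_top hT hY hY0 hYfin hp) h hA
  rw [setLIntegral_indicator_one hY] at h1
  refine h1.trans_eq ?_
  rw [mul_assoc, Finset.mul_sum (a := (wanderingRate μ T Y p)⁻¹)]
  congr 1
  exact Finset.sum_congr rfl fun i _ =>
    setLIntegral_entranceDensity hT hY hYfin p (hT.measurable.iterate i hA)

end Density

/-! ### Two-sided bounds on the gap probability -/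

section Bounds

variable {X : Type*} [MeasurableSpace X] {μ : Measure X} [SigmaFinite μ] {T : X → X} {Y : Set X}

omit [SigmaFinite μ] in
-- Since n q_n ≥ w_{2n} - w_n and w_{2n} / w_n eventually exceeds the midpoint of 1 and 2^(1-α),
-- half of 2^(1-α) - 1 serves as constant.
theorem exists_le_measure_excursion (hT : MeasurePreserving T μ μ) (hY : MeasurableSet Y)
    (hY0 : μ Y ≠ 0) (hYfin : μ Y ≠ ∞) {α : ℝ} (hα1 : α < 1) {ℓ : ℝ → ℝ} (hℓ : SlowlyVarying ℓ)
    (hw : Tendsto (fun n : ℕ => (wanderingRate μ T Y n).toReal / ((n : ℝ) ^ (1 - α) * ℓ n))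
      atTop (𝓝 1)) :
    ∃ a : ℝ, 0 < a ∧ ∀ᶠ n : ℕ in atTop,
      a * ((wanderingRate μ T Y n).toReal / n) ≤ (μ (excursion T Y n)).toReal := by
  have h1 : (1 : ℝ) < 2 ^ (1 - α) := Real.one_lt_rpow one_lt_two (by linarith)
  refine ⟨(2 ^ (1 - α) - 1) / 2, by linarith, ?_⟩
  filter_upwards [(tendsto_order.1 (tendsto_two_mul_div hℓ hw)).1 ((2 ^ (1 - α) + 1) / 2)
    (by linarith), eventually_gt_atTop 0] with n hn hn0
  have hn0' : (0 : ℝ) < n := by exact_mod_cast hn0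
  have hfin := wanderingRate_ne_top hT hY hYfin
  have hWpos : 0 < (wanderingRate μ T Y n).toReal :=
    ENNReal.toReal_pos (wanderingRate_ne_zero hY0 hn0) (hfin n)
  have hqfin : μ (excursion T Y n) ≠ ∞ := measure_ne_top_of_subset (excursion_subset n) hYfin
  have h2 := ENNReal.toReal_mono (ENNReal.add_ne_top.2
    ⟨hfin n, ENNReal.mul_ne_top (ENNReal.natCast_ne_top n) hqfin⟩)
    (wanderingRate_two_mul_le hT hY n)
  rw [ENNReal.toReal_add (hfin n) (ENNReal.mul_ne_top (ENNReal.natCast_ne_top n) hqfin),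
    ENNReal.toReal_mul, ENNReal.toReal_natCast] at h2
  rw [lt_div_iff₀ hWpos] at hn
  rw [← mul_div_assoc, div_le_iff₀ hn0']
  linarith

theorem exists_le_measure_noVisit (hT : MeasurePreserving T μ μ) (hY : MeasurableSet Y)
    (hY0 : μ Y ≠ 0) (hYfin : μ Y ≠ ∞) {α : ℝ} (hα1 : α < 1) {ℓ : ℝ → ℝ} (hℓ : SlowlyVarying ℓ)
    (hw : Tendsto (fun n : ℕ => (wanderingRate μ T Y n).toReal / ((n : ℝ) ^ (1 - α) * ℓ n))
      atTop (𝓝 1))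
    {H : X → ℝ} (hH : IsAsymptoticEntranceDensity μ T Y H)
    {ν : Measure X} [IsFiniteMeasure ν] {C : ℝ≥0} (hC : 0 < C) {K : ℕ}
    (hν : ∀ A, MeasurableSet A → μ (Y ∩ A) ≤ C * ∑ i ∈ Finset.range (K + 1), ν (T^[i] ⁻¹' A)) :
    ∃ a : ℝ, 0 < a ∧ ∃ M : ℕ, ∀ m n : ℕ, M ≤ m → m ≤ n →
      a * (m / (wanderingRate μ T Y m).toReal * ((wanderingRate μ T Y n).toReal / n)) ≤
        (ν (noVisit T Y m n)).toReal := by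
  obtain ⟨b, hb, N, hN⟩ := exists_entranceMass_le hT hY hY0 hYfin hH
  obtain ⟨κ, hκ, hev⟩ := exists_le_measure_excursion hT hY hY0 hYfin hα1 hℓ hw
  obtain ⟨N', hN'⟩ := eventually_atTop.1 hev
  have hb' : (0 : ℝ) < b := hb
  have hC' : (0 : ℝ) < C := hC
  set D : ℝ := b * (C * (K + 1)) with hD
  have hDpos : 0 < D := by positivity
  -- With p = m - K, the threshold gives p ≥ N, n ≥ N' and m ≤ 2p; the last is the source of the 2.
  refine ⟨κ / (2 * D), by positivity, N + N' + 2 * K + 1, fun m n hm hmn => ?_⟩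
  have hfin := wanderingRate_ne_top hT hY hYfin
  have hB := measurableSet_excursion hT.measurable hY n
  obtain ⟨p, rfl⟩ : ∃ p, m = p + K := ⟨m - K, by omega⟩
  have h1 := mul_measure_le_visitMass hT hY (hN p (by omega)) hB (excursion_subset n)
  have h2 := visitMass_excursion_le hT.measurable hY hν hmn
  have h3 : (p : ℝ≥0∞) * μ (excursion T Y n) ≤ b * wanderingRate μ T Y (p + K) *
      (C * ((K + 1 : ℕ) * ν (noVisit T Y (p + K) n))) := by
    refine h1.trans ?_
    gcongr
    exact wanderingRate_mono (Nat.le_add_right p K)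
  have h4 := ENNReal.toReal_mono (by have := hfin (p + K); finiteness) h3
  simp only [ENNReal.toReal_mul, ENNReal.toReal_natCast, ENNReal.coe_toReal] at h4
  have hWm : 0 < (wanderingRate μ T Y (p + K)).toReal :=
    ENNReal.toReal_pos (wanderingRate_ne_zero hY0 (by omega)) (hfin _)
  have hq := hN' n (by omega)
  have hpK : ((p + K : ℕ) : ℝ) ≤ 2 * p := by
    have : p + K ≤ 2 * p := by omega
    exact_mod_cast this
  generalize (wanderingRate μ T Y (p + K)).toReal = W at *
  have hR : 0 ≤ κ * ((wanderingRate μ T Y n).toReal / n) := by positivity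
  generalize (wanderingRate μ T Y n).toReal / n = R at *
  generalize (ν (noVisit T Y (p + K) n)).toReal = V at *
  have h5 : (p : ℝ) * (κ * R) ≤ D * W * V := by
    refine (mul_le_mul_of_nonneg_left hq (Nat.cast_nonneg p)).trans (h4.trans_eq ?_)
    rw [hD]
    push_cast
    ring
  have h6 : ((p + K : ℕ) : ℝ) * (κ * R) ≤ 2 * p * (κ * R) := mul_le_mul_of_nonneg_right hpK hR
  have h7 : κ / (2 * D) * (((p + K : ℕ) : ℝ) / W * R) =
      (((p + K : ℕ) : ℝ) * (κ * R)) / (2 * D * W) := by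
    field_simp
  rw [h7, div_le_iff₀ (by positivity)]
  linarith

theorem exists_measure_noVisit_le (hT : MeasurePreserving T μ μ) (hY : MeasurableSet Y)
    (hY0 : μ Y ≠ 0) (hYfin : μ Y ≠ ∞) {N : ℕ}
    (hsweep : UniformlySweepingFamily μ T (entranceDensity μ T Y '' Set.Ici N) (Y.indicator 1))
    {ν : Measure X} {C : ℝ≥0} (hC : 0 < C) {K : ℕ}
    (hν : ∀ A, MeasurableSet A → ν A ≤ C * ∑ i ∈ Finset.range (K + 1), μ (Y ∩ T^[i] ⁻¹' A)) :
    ∃ a : ℝ, 0 < a ∧ ∃ M : ℕ, ∀ m n : ℕ, M ≤ m → 2 * m ≤ n →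
      (ν (noVisit T Y m n)).toReal ≤
        a * (m / (wanderingRate μ T Y m).toReal * ((wanderingRate μ T Y n).toReal / n)) := by
  obtain ⟨C', hC', K', hsw⟩ := hsweep
  have hC0 : (0 : ℝ) < C := hC
  have hC0' : (0 : ℝ) < C' := hC'
  set D : ℝ := C * ((K + 1) * (C' * (K' + 1))) with hD
  have hDpos : 0 < D := by positivity
  -- The threshold bounds the renewal length (m + K + 1) + K' + m by 3m; the other factor 2 comes
  -- from n ≤ 2(n - m).
  refine ⟨6 * D, by positivity, N + K + K' + 1, fun m n hm hmn => ?_⟩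
  have hfin := wanderingRate_ne_top hT hY hYfin
  have hWm0 := wanderingRate_ne_zero (T := T) hY0 (n := m) (by omega)
  have hqfin : μ (excursion T Y (n - m)) ≠ ∞ :=
    measure_ne_top_of_subset (excursion_subset _) hYfin
  have h1 : ∀ A, MeasurableSet A → μ (Y ∩ A) ≤ C' * (wanderingRate μ T Y m)⁻¹ *
      ∑ i ∈ Finset.range (K' + 1), entranceMass μ T Y m (T^[i] ⁻¹' A) := fun A hA =>
    measure_inter_le_entranceMass hT hY hY0 hYfin (by omega)
      (hsw _ ⟨m, by simp only [Set.mem_Ici]; omega, rfl⟩) hA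
  have h2 := visitMass_le_mul_measure hT hY h1
    (measurableSet_excursion hT.measurable hY (n - m)) (excursion_subset _) (m + K + 1)
  have h3 : ν (noVisit T Y m n) ≤ C * ((K + 1 : ℕ) * (C' * (wanderingRate μ T Y m)⁻¹ *
      ((K' + 1 : ℕ) * ((3 * m : ℕ) * μ (excursion T Y (n - m)))))) := by
    refine (measure_noVisit_le hT.measurable hY hν).trans ?_
    gcongr
    refine h2.trans ?_
    gcongr
    omega
  have hinv : (wanderingRate μ T Y m)⁻¹ ≠ ∞ := ENNReal.inv_ne_top.2 hWm0
  have h4 := ENNReal.toReal_mono (by finiteness) h3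
  have h5 := ENNReal.toReal_mono (hfin _) ((mul_measure_excursion_le hT hY (n - m)).trans
    (wanderingRate_mono (Nat.sub_le n m)))
  simp only [ENNReal.toReal_mul, ENNReal.toReal_natCast, ENNReal.coe_toReal,
    ENNReal.toReal_inv] at h4 h5
  have hn0 : (0 : ℝ) < n := by
    have : 0 < n := by omega
    exact_mod_cast this
  have hnm : (n : ℝ) ≤ 2 * ((n - m : ℕ) : ℝ) := by
    have : n ≤ 2 * (n - m) := by omega
    exact_mod_cast this
  have hWm : 0 < (wanderingRate μ T Y m).toReal := ENNReal.toReal_pos hWm0 (hfin _)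
  have hq0 : 0 ≤ (μ (excursion T Y (n - m))).toReal := ENNReal.toReal_nonneg
  generalize (μ (excursion T Y (n - m))).toReal = q at *
  have h6 : q ≤ 2 * ((wanderingRate μ T Y n).toReal / n) := by
    rw [← mul_div_assoc, le_div_iff₀ hn0]
    nlinarith [mul_le_mul_of_nonneg_right hnm hq0]
  generalize (wanderingRate μ T Y m).toReal = W at *
  generalize (wanderingRate μ T Y n).toReal / n = R at *
  calc (ν (noVisit T Y m n)).toReal ≤ _ := h4
    _ = 3 * D * (m / W) * q := by
        rw [hD]
        push_cast
        field_simp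
    _ ≤ 3 * D * (m / W) * (2 * R) := by gcongr
    _ = 6 * D * (m / W * R) := by ring

end Bounds

/-! ### From the normalised probability to gap events -/

section NormalizedProb

variable {X : Type*} [MeasurableSpace X] {μ : Measure X} {T : X → X} {Y : Set X}

theorem setIntegral_lastVisit_eq (hT : Measurable T) (hY : MeasurableSet Y) {G : X → ℝ}
    (hG : Integrable G μ) (hG0 : 0 ≤ᵐ[μ] G) {c : ℝ} (hc : 0 ≤ c) {n : ℕ} (hn : 0 < n) :
    ∫ x in {x | (lastVisit T Y n x : ℝ) / (n : ℝ) ≤ c}, G x ∂μ =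
      (μ.withDensity (fun x => ENNReal.ofReal (G x)) (noVisit T Y ⌊c * n⌋₊ n)).toReal := by
  have hn' : (0 : ℝ) < n := by exact_mod_cast hn
  have hset : {x | (lastVisit T Y n x : ℝ) / (n : ℝ) ≤ c} = noVisit T Y ⌊c * n⌋₊ n := by
    ext x
    rw [← lastVisit_le_iff, Nat.le_floor_iff (by positivity), ← div_le_iff₀ hn']
    rfl
  rw [hset, withDensity_apply _ (measurableSet_noVisit hT hY _ _),
    integral_eq_lintegral_of_nonneg_ae (ae_restrict_of_ae hG0) hG.aestronglyMeasurable.restrict]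

theorem eventually_le_floor_mul {c : ℕ → ℝ} (ht : Tendsto (fun n : ℕ => c n * n) atTop atTop) (M : ℕ) :
    ∀ᶠ n : ℕ in atTop, M ≤ ⌊c n * n⌋₊ :=
  (tendsto_nat_floor_atTop.comp ht).eventually_ge_atTop M

theorem eventually_two_mul_floor_le {c : ℕ → ℝ} (hc : ∀ n, 0 < c n)
    (hc0 : Tendsto c atTop (𝓝 0)) : ∀ᶠ n : ℕ in atTop, 2 * ⌊c n * n⌋₊ ≤ n := by
  filter_upwards [(tendsto_order.1 hc0).2 (1 / 2) (by norm_num)] with n hn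
  have h1 : (⌊c n * n⌋₊ : ℝ) ≤ c n * n := Nat.floor_le (mul_nonneg (hc n).le n.cast_nonneg)
  have h2 : (2 * ⌊c n * n⌋₊ : ℝ) ≤ n := by
    nlinarith [mul_le_mul_of_nonneg_right hn.le (n.cast_nonneg (α := ℝ))]
  exact_mod_cast h2

end NormalizedProb

end InfErg

open InfErg in
theorem mainTheorem6 {X : Type*} [MeasurableSpace X] (μ : Measure X) [SigmaFinite μ]
    (hμ : μ Set.univ = ∞)
    (T : X → X) (hcons : Conservative T μ) (herg : Ergodic T μ)
    (Y : Set X) (hY : MeasurableSet Y) (hY0 : 0 < μ Y) (hYfin : μ Y < ∞)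
    (α : ℝ) (hα0 : 0 < α) (hα1 : α < 1) (ℓ : ℝ → ℝ) (hℓ : InfErg.SlowlyVarying ℓ)
    (hw : Tendsto
      (fun n : ℕ => (InfErg.wanderingRate μ T Y n).toReal / ((n : ℝ) ^ (1 - α) * ℓ n))
      atTop (𝓝 1))
    (hsweep : ∃ N : ℕ, 0 < N ∧ InfErg.UniformlySweepingFamily μ T
      (InfErg.entranceDensity μ T Y '' Set.Ici N) (Y.indicator 1))
    (hdens : ∃ H : X → ℝ, InfErg.IsAsymptoticEntranceDensity μ T Y H)
    (G : X → ℝ) (hG : Integrable G μ) (hG0 : 0 ≤ᵐ[μ] G) :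
    (InfErg.UniformlySweeping μ T (fun x => ENNReal.ofReal (G x)) (Y.indicator 1) →
      ∃ C₁ : ℝ, 0 < C₁ ∧ ∀ c : ℕ → ℝ, (∀ n, 0 < c n) →
        Tendsto c atTop (𝓝 0) → Tendsto (fun n : ℕ => c n * n) atTop atTop →
        (C₁ : EReal) ≤
          liminf (fun n : ℕ => (InfErg.normalizedProb μ T Y α ℓ G c n : EReal)) atTop) ∧
    (InfErg.UniformlySweeping μ T (Y.indicator 1) (fun x => ENNReal.ofReal (G x)) →
      ∃ C₂ : ℝ, 0 < C₂ ∧ ∀ c : ℕ → ℝ, (∀ n, 0 < c n) →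
        Tendsto c atTop (𝓝 0) → Tendsto (fun n : ℕ => c n * n) atTop atTop →
        limsup (fun n : ℕ => (InfErg.normalizedProb μ T Y α ℓ G c n : EReal)) atTop ≤
          (C₂ : EReal)) := by
  have hT : MeasurePreserving T μ μ := herg.toMeasurePreserving
  have hum : AEMeasurable (fun x => ENNReal.ofReal (G x)) μ := hG.aemeasurable.ennreal_ofReal
  have hu : ∫⁻ x, ENNReal.ofReal (G x) ∂μ ≠ ∞ := hG.lintegral_lt_top.ne
  have hfin : IsFiniteMeasure (μ.withDensity fun x => ENNReal.ofReal (G x)) :=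
    isFiniteMeasure_withDensity hu
  have hfac : ∀ (c : ℕ → ℝ) (n : ℕ), (∀ n, 0 < c n) → 0 < n →
      0 ≤ ℓ (c n * n) / (c n ^ α * ℓ n) := by
    intro c n hc hn
    have hn' : (0 : ℝ) < n := by exact_mod_cast hn
    have h1 := hℓ.pos _ hn'
    have h2 := hℓ.pos _ (mul_pos (hc n) hn')
    have h3 := Real.rpow_pos_of_pos (hc n) α
    positivity
  constructor
  · rintro ⟨C, hC, K, hsw⟩
    obtain ⟨H, hH⟩ := hdens
    have hν : ∀ A, MeasurableSet A → μ (Y ∩ A) ≤ C * ∑ i ∈ Finset.range (K + 1),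
        μ.withDensity (fun x => ENNReal.ofReal (G x)) (T^[i] ⁻¹' A) := by
      intro A hA
      have h := setLIntegral_le_of_sweeping hT hum hu (hsw _ rfl) hA
      rw [setLIntegral_indicator_one hY] at h
      refine h.trans_eq ?_
      congr 1
      exact Finset.sum_congr rfl fun i _ =>
        (withDensity_apply _ (hT.measurable.iterate i hA)).symm
    obtain ⟨a, ha, M, hM⟩ :=
      exists_le_measure_noVisit hT hY hY0.ne' hYfin.ne hα1 hℓ hw hH hC hν
    -- The normalisation tends to 1, so it eventually exceeds 1/2; the upper bound below uses 2
    -- likewise.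
    refine ⟨a / 2, by positivity, fun c hc hc0 ht => ?_⟩
    refine le_liminf_of_le (by isBoundedDefault) ?_
    filter_upwards [(tendsto_order.1 (tendsto_normalization hℓ hw hc ht)).1 (1 / 2) (by norm_num),
      eventually_le_floor_mul ht M, eventually_two_mul_floor_le hc hc0, eventually_gt_atTop 0]
      with n h1 h2 h3 h4
    rw [EReal.coe_le_coe_iff, normalizedProb,
      setIntegral_lastVisit_eq hT.measurable hY hG hG0 (hc n).le h4]
    refine le_trans ?_ (mul_le_mul_of_nonneg_left (hM _ n h2 (by omega)) (hfac c n hc h4))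
    rw [mul_left_comm]
    nlinarith
  · rintro ⟨C, hC, K, hsw⟩
    obtain ⟨N, -, hsweep⟩ := hsweep
    have hν : ∀ A, MeasurableSet A → μ.withDensity (fun x => ENNReal.ofReal (G x)) A ≤
        C * ∑ i ∈ Finset.range (K + 1), μ (Y ∩ T^[i] ⁻¹' A) := by
      intro A hA
      have h := setLIntegral_le_of_sweeping hT (u := Y.indicator 1) (aemeasurable_one.indicator hY)
        (by rw [lintegral_indicator_one hY]; exact hYfin.ne) (hsw _ rfl) hA
      rw [withDensity_apply _ hA]
      refine h.trans_eq ?_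
      congr 1
      exact Finset.sum_congr rfl fun i _ => setLIntegral_indicator_one hY _
    obtain ⟨a, ha, M, hM⟩ := exists_measure_noVisit_le hT hY hY0.ne' hYfin.ne hsweep hC hν
    refine ⟨a * 2, by positivity, fun c hc hc0 ht => ?_⟩
    refine limsup_le_of_le (by isBoundedDefault) ?_
    filter_upwards [(tendsto_order.1 (tendsto_normalization hℓ hw hc ht)).2 2 (by norm_num),
      eventually_le_floor_mul ht M, eventually_two_mul_floor_le hc hc0, eventually_gt_atTop 0]
      with n h1 h2 h3 h4
    rw [EReal.coe_le_coe_iff, normalizedProb,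
      setIntegral_lastVisit_eq hT.measurable hY hG hG0 (hc n).le h4]
    refine (mul_le_mul_of_nonneg_left (hM _ n h2 h3) (hfac c n hc h4)).trans ?_
    rw [mul_left_comm]
    nlinarith
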